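/- Let $X=\{x_1,x_2,\dots\}$ be a countably infinite alphabet. A *word* is an element $w=w(x_1,\dots,x_n)$ of the free group $F(X)$, and for a group $G$ we let $w[G]=\{w(g_1,\dots,g_n) : g_1,\dots,g_n\in G\}$ be the set of all values of $w$ in $G$. A word $w$ is *proper* if there exist groups $G_1,G_2$ with $w[G_1]\neq\{1\}$ and $w[G_2]\neq G_2$. The *rational subsets* of a monoid $M$ form the smallest family of subsets of $M$ that contains all finite subsets and is closed under union $L_1\cup L_2$, product $L_1L_2=\{ab : a\in L_1,\ b\in L_2\}$, and passing from $L$ to the submonoid $L^{*}$ generated by $L$. A set is *rational in* a group $G$ if it is a rational subset of $G$ regarded as a monoid. The following hold. 1. If $\varphi\colon M\to N$ is a homomorphism of monoids and $L\subseteq M$ is rational in $M$, then $\varphi(L)$ is rational in $N$. 2. If $\varphi\colon H\to G$ is a surjective homomorphism of groups, then $w[G]=\varphi(w[H])$ for every word $w$. 3. If a group $H$ admits a homomorphism onto a group $G$ such that $w[G]$ is not rational in $G$ for every proper word $w$, then $w[H]$ is not rational in $H$ for every proper word $w$. 4. If a group $H$ admits a homomorphism onto a free non-abelian group (of any rank,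 finite or infinite), then $w[H]$ is not rational in $H$ for every proper word $w$. -/

import Mathlib

open scoped Pointwise

universe u v p

/-- The rational subsets of a monoid `M`: the smallest family of subsets of `M` which contains all
finite subsets and is closed under union, product of subsets, and generation of a submonoid. -/
inductive IsRationalSubset {M : Type u} [Monoid M] : Set M → Prop
  | finite (L : Set M) (hL : L.Finite) : IsRationalSubset L
  | union (L₁ L₂ : Set M) (h₁ : IsRationalSubset L₁) (h₂ : IsRationalSubset L₂) :
      IsRationalSubset (L₁ ∪ L₂)
  | mul (L₁ L₂ : Set M) (h₁ : IsRationalSubset L₁) (h₂ : IsRationalSubset L₂) :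
      IsRationalSubset (L₁ * L₂)
  | star (L : Set M) (h : IsRationalSubset L) :
      IsRationalSubset (Submonoid.closure L : Set M)

/-- Group words: elements of the free group on a countably infinite alphabet. -/
abbrev GroupWord : Type := FreeGroup ℕ

/-- The verbal set `w[G]`: all values `w(g₀, g₁, …)` of the word `w` in the group `G`. -/
def verbalSet (w : GroupWord) (G : Type u) [Group G] : Set G :=
  {g | ∃ f : ℕ → G, FreeGroup.lift f w = g}

/-- A word `w` is proper if `w[G] ≠ 1` for some group `G` and `w[H] ≠ H` for some group `H`.
The groups range over an arbitrary universe `p`; the property does not depend on it. -/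
def IsProperWord (w : GroupWord) : Prop :=
  (∃ (G : Type p) (_ : Group G), verbalSet w G ≠ {1}) ∧
    ∃ (H : Type p) (_ : Group H), verbalSet w H ≠ Set.univ

/-!
The first three assertions are formal: homomorphisms commute with the rational operations, and the
values of a word can be lifted along a surjection. Since a free non-abelian group maps onto the free
group `F₂` on two letters `a`, `b`, the last assertion reduces to the claim that `w[F₂]` is not
rational in `F₂` for a proper word `w`. Two facts are played against each other.

*Values of `w` have few syllables modulo `n`.* As `w` is proper, `w ≠ 1` and some `n ≥ 2` divides
all the exponent sums of `w` (`IsProperWord.exists_dvd`). For `g` in `F₂`, count for each `m` the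
maximal syllables `a ^ m` of the reduced word of `g` minus the syllables `a ^ (-m)`. Multiplying two
elements changes these counts, compared to their sum, only for a bounded number of `m`
(`card_support_syllableCount_mul_le`), because only the syllables around the cancellation are
affected. Hence for `g` in `w[F₂]` the number of `m` for which the count is not divisible by `n` is
bounded by a constant depending on `w` only.

*Rational sets can be pumped.* A rational subset is the set of labels of the accepted paths of a
finite graph with edges labelled by letters or `1` (`IsRationalSubset.acceptedWithLabels`). As the
Cayley graph of `F₂` is a tree, a path reading a reduced word `U ++ V` passes through the element
`U` (`AutomatonPath.exists_split`), so that long powers of `a` in the reduced word of an element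
can be pumped inside the set (`AutomatonPath.exists_pump_syllableWord`).

Now `w[F₂]` contains a nontrivial `g` and, with it, `h⁻¹ * g * h` for
`h = c * a ^ k₀ * b * a ^ k₁ * b ⋯`, where the letter `c` prevents cancellation. Pumping only the
powers of `a` in the right factor `h` produces an element of `w[F₂]` in which the syllables of
length `-kᵢ` are no longer balanced by syllables of length `kᵢ`; taking many `kᵢ` contradicts
the bound.
-/

/-! ### Finite automata labelled by elements of a monoid -/

/-- `AutomatonPath E p q g`: in the directed graph on `Q` whose edges from `p` to `q` are labelled by
the elements of `E p q`, some path from `p` to `q` has label product `g`. -/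
inductive AutomatonPath {M : Type u} [Monoid M] {Q : Type} (E : Q → Q → Set M) (p : Q) :
    Q → M → Prop
  | nil : AutomatonPath E p p 1
  | snoc {q r : Q} {g s : M} : AutomatonPath E p q g → s ∈ E q r → AutomatonPath E p r (g * s)

namespace AutomatonPath

variable {M : Type u} [Monoid M] {Q Q₁ Q₂ : Type}

theorem trans {E : Q → Q → Set M} {p q r : Q} {g h : M} (h₁ : AutomatonPath E p q g)
    (h₂ : AutomatonPath E q r h) : AutomatonPath E p r (g * h) := by
  induction h₂ with
  | nil => simpa using h₁
  | snoc _ hs ih => rw [← mul_assoc]; exact ih.snoc hs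

theorem edge {E : Q → Q → Set M} {p q : Q} {s : M} (hs : s ∈ E p q) : AutomatonPath E p q s := by
  simpa using (AutomatonPath.nil (E := E) (p := p)).snoc hs

theorem map {E₁ : Q₁ → Q₁ → Set M} {E₂ : Q₂ → Q₂ → Set M} (f : Q₁ → Q₂)
    (hE : ∀ p q, E₁ p q ⊆ E₂ (f p) (f q)) {p q : Q₁} {g : M} (h : AutomatonPath E₁ p q g) :
    AutomatonPath E₂ (f p) (f q) g := by
  induction h with
  | nil => exact nil
  | snoc _ hs ih => exact ih.snoc (hE _ _ hs)

end AutomatonPath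

/-- The disjoint union of two labelled graphs, with additional edges `X p q` from the vertices of
the first graph to those of the second. -/
def joinEdges {M : Type u} {Q₁ Q₂ : Type} (E₁ : Q₁ → Q₁ → Set M) (E₂ : Q₂ → Q₂ → Set M)
    (X : Q₁ → Q₂ → Set M) : Q₁ ⊕ Q₂ → Q₁ ⊕ Q₂ → Set M
  | .inl p, .inl q => E₁ p q
  | .inl p, .inr q => X p q
  | .inr _, .inl _ => ∅
  | .inr p, .inr q => E₂ p q

section Join

variable {M : Type u} [Monoid M] {Q₁ Q₂ : Type} {E₁ : Q₁ → Q₁ → Set M} {E₂ : Q₂ → Q₂ → Set M}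
  {X : Q₁ → Q₂ → Set M}

theorem path_joinEdges_from_inl {p : Q₁} {y : Q₁ ⊕ Q₂} {g : M}
    (h : AutomatonPath (joinEdges E₁ E₂ X) (.inl p) y g) :
    (∀ q, y = .inl q → AutomatonPath E₁ p q g) ∧
    (∀ q, y = .inr q → ∃ p' q' g₁ x g₂, AutomatonPath E₁ p p' g₁ ∧ x ∈ X p' q' ∧
      AutomatonPath E₂ q' q g₂ ∧ g = g₁ * x * g₂) := by
  induction h with
  | nil => exact ⟨by rintro q ⟨⟩; exact .nil, by rintro q ⟨⟩⟩
  | @snoc y z g s _ hs ih =>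
    rcases y with y | y <;> rcases z with z | z
    · exact ⟨by rintro q ⟨⟩; exact (ih.1 _ rfl).snoc hs, by rintro q ⟨⟩⟩
    · exact ⟨by rintro q ⟨⟩, by
        rintro q ⟨⟩; exact ⟨y, _, g, s, 1, ih.1 _ rfl, hs, .nil, by simp⟩⟩
    · exact hs.elim
    · refine ⟨by rintro q ⟨⟩, ?_⟩
      rintro q ⟨⟩
      obtain ⟨p', q', g₁, x, g₂, h₁, hx, h₂, rfl⟩ := ih.2 _ rfl
      exact ⟨p', q', g₁, x, g₂ * s, h₁, hx, h₂.snoc hs, by simp [mul_assoc]⟩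

theorem path_joinEdges_from_inr {p : Q₂} {y : Q₁ ⊕ Q₂} {g : M}
    (h : AutomatonPath (joinEdges E₁ E₂ X) (.inr p) y g) :
    ∃ q, y = .inr q ∧ AutomatonPath E₂ p q g := by
  induction h with
  | nil => exact ⟨_, rfl, .nil⟩
  | @snoc y z g s _ hs ih =>
    obtain ⟨q, rfl, hq⟩ := ih
    rcases z with z | z
    · exact hs.elim
    · exact ⟨_, rfl, hq.snoc hs⟩

theorem AutomatonPath.inl {p q : Q₁} {g : M} (h : AutomatonPath E₁ p q g) :
    AutomatonPath (joinEdges E₁ E₂ X) (.inl p) (.inl q) g :=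
  h.map Sum.inl fun _ _ => subset_rfl

theorem AutomatonPath.inr {p q : Q₂} {g : M} (h : AutomatonPath E₂ p q g) :
    AutomatonPath (joinEdges E₁ E₂ X) (.inr p) (.inr q) g :=
  h.map Sum.inr fun _ _ => subset_rfl

end Join

/-- `L` is the set of label products of the paths from `I` to `F` in a finite graph whose edges
carry labels in `T`. The label `1 ∈ T` plays the role of an empty transition. -/
def AcceptedWithLabels {M : Type u} [Monoid M] (T : Set M) (L : Set M) : Prop :=
  ∃ (Q : Type) (_ : Finite Q) (E : Q → Q → Set M) (I F : Set Q), (∀ p q, E p q ⊆ T) ∧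
    ∀ g, g ∈ L ↔ ∃ i ∈ I, ∃ f ∈ F, AutomatonPath E i f g

namespace AcceptedWithLabels

variable {M : Type u} [Monoid M] {T L₁ L₂ L : Set M}

theorem empty : AcceptedWithLabels T (∅ : Set M) :=
  ⟨Unit, inferInstance, fun _ _ => ∅, ∅, ∅, by simp, by simp⟩

theorem one : AcceptedWithLabels T ({1} : Set M) := by
  refine ⟨Unit, inferInstance, fun _ _ => ∅, Set.univ, Set.univ, by simp, fun g => ?_⟩
  constructor
  · rintro rfl; exact ⟨(), trivial, (), trivial, .nil⟩
  · rintro ⟨_, _, _, _, h⟩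
    cases h with
    | nil => rfl
    | snoc _ hs => exact hs.elim

theorem union (h₁ : AcceptedWithLabels T L₁) (h₂ : AcceptedWithLabels T L₂) :
    AcceptedWithLabels T (L₁ ∪ L₂) := by
  obtain ⟨Q₁, _, E₁, I₁, F₁, hT₁, hL₁⟩ := h₁
  obtain ⟨Q₂, _, E₂, I₂, F₂, hT₂, hL₂⟩ := h₂
  refine ⟨Q₁ ⊕ Q₂, inferInstance, joinEdges E₁ E₂ fun _ _ => ∅, Sum.elim I₁ I₂, Sum.elim F₁ F₂,
    ?_, fun g => ?_⟩
  · rintro (p | p) (q | q)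
    exacts [hT₁ p q, Set.empty_subset _, Set.empty_subset _, hT₂ p q]
  · rw [Set.mem_union, hL₁, hL₂]
    constructor
    · rintro (⟨i, hi, f, hf, h⟩ | ⟨i, hi, f, hf, h⟩)
      · exact ⟨.inl i, hi, .inl f, hf, h.inl⟩
      · exact ⟨.inr i, hi, .inr f, hf, h.inr⟩
    · rintro ⟨i | i, hi, f | f, hf, h⟩
      · exact .inl ⟨i, hi, f, hf, (path_joinEdges_from_inl h).1 _ rfl⟩
      · obtain ⟨_, _, _, _, _, _, hx, _⟩ := (path_joinEdges_from_inl h).2 _ rfl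
        exact hx.elim
      · obtain ⟨_, ⟨⟩, _⟩ := path_joinEdges_from_inr h
      · obtain ⟨_, ⟨⟩, h⟩ := path_joinEdges_from_inr h
        exact .inr ⟨i, hi, f, hf, h⟩

theorem mul (hT : 1 ∈ T) (h₁ : AcceptedWithLabels T L₁) (h₂ : AcceptedWithLabels T L₂) :
    AcceptedWithLabels T (L₁ * L₂) := by
  obtain ⟨Q₁, _, E₁, I₁, F₁, hT₁, hL₁⟩ := h₁
  obtain ⟨Q₂, _, E₂, I₂, F₂, hT₂, hL₂⟩ := h₂
  refine ⟨Q₁ ⊕ Q₂, inferInstance, joinEdges E₁ E₂ fun p q => {x | x = 1 ∧ p ∈ F₁ ∧ q ∈ I₂},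
    Sum.elim I₁ (∅ : Set Q₂), Sum.elim (∅ : Set Q₁) F₂, ?_, fun g => ?_⟩
  · rintro (p | p) (q | q)
    · exact hT₁ p q
    · rintro x ⟨rfl, _⟩; exact hT
    · exact Set.empty_subset _
    · exact hT₂ p q
  · rw [Set.mem_mul]
    constructor
    · rintro ⟨g₁, hg₁, g₂, hg₂, rfl⟩
      obtain ⟨i, hi, f, hf, h⟩ := (hL₁ _).1 hg₁
      obtain ⟨i', hi', f', hf', h'⟩ := (hL₂ _).1 hg₂
      refine ⟨.inl i, hi, .inr f', hf', ?_⟩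
      have := (h.inl.snoc (E := joinEdges E₁ E₂ fun p q => {x | x = 1 ∧ p ∈ F₁ ∧ q ∈ I₂})
        (r := .inr i') ⟨rfl, hf, hi'⟩).trans h'.inr
      simpa using this
    · rintro ⟨i | i, hi, f | f, hf, h⟩
      · exact hf.elim
      · obtain ⟨p', q', g₁, x, g₂, h₁, ⟨rfl, hp, hq⟩, h₂, rfl⟩ :=
          (path_joinEdges_from_inl h).2 _ rfl
        exact ⟨g₁, (hL₁ _).2 ⟨i, hi, p', hp, h₁⟩, g₂, (hL₂ _).2 ⟨q', hq, f, hf, h₂⟩, by simp⟩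
      · exact hi.elim
      · exact hi.elim

theorem star (hT : 1 ∈ T) (hL : AcceptedWithLabels T L) :
    AcceptedWithLabels T (Submonoid.closure L : Set M) := by
  obtain ⟨Q, _, E, I, F, hET, hL⟩ := hL
  let E' : Q → Q → Set M := fun p q => E p q ∪ {x | x = 1 ∧ p ∈ F ∧ q ∈ I}
  have lift : ∀ {p q g}, AutomatonPath E p q g → AutomatonPath E' p q g := fun h =>
    h.map (E₂ := E') id fun _ _ => Set.subset_union_left
  -- The graph with edges `E'` accepts the nonempty products of elements of `L`.
  let L' : Set M := {g | ∃ i ∈ I, ∃ f ∈ F, AutomatonPath E' i f g}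
  have hL' : AcceptedWithLabels T L' := by
    refine ⟨Q, inferInstance, E', I, F, fun p q => Set.union_subset (hET p q) ?_, fun g => Iff.rfl⟩
    rintro x ⟨rfl, _⟩; exact hT
  have key : ∀ {i q g}, i ∈ I → AutomatonPath E' i q g →
      ∃ m ∈ Submonoid.closure L, ∃ i' ∈ I, ∃ g', g = m * g' ∧ AutomatonPath E i' q g' := by
    intro i q g hi h
    induction h with
    | nil => exact ⟨1, one_mem _, i, hi, 1, by simp, .nil⟩
    | @snoc q r g s _ hs ih =>
      obtain ⟨m, hm, i', hi', g', rfl, h'⟩ := ih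
      rcases hs with hs | ⟨rfl, hq, hr⟩
      · exact ⟨m, hm, i', hi', g' * s, by simp [mul_assoc], h'.snoc hs⟩
      · exact ⟨m * g', mul_mem hm (Submonoid.subset_closure ((hL _).2 ⟨i', hi', q, hq, h'⟩)),
          r, hr, 1, by simp, .nil⟩
  convert one.union hL' using 1
  ext g
  constructor
  · intro hg
    induction hg using Submonoid.closure_induction with
    | mem x hx =>
      obtain ⟨i, hi, f, hf, h⟩ := (hL _).1 hx
      exact .inr ⟨i, hi, f, hf, lift h⟩
    | one => exact .inl rfl
    | mul x y _ _ hx hy =>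
      rcases hx with rfl | ⟨i, hi, f, hf, h⟩
      · simpa using hy
      rcases hy with rfl | ⟨i', hi', f', hf', h'⟩
      · rw [mul_one]; exact .inr ⟨i, hi, f, hf, h⟩
      · refine .inr ⟨i, hi, f', hf', ?_⟩
        have := (h.snoc (r := i') (s := 1) (.inr ⟨rfl, hf, hi'⟩)).trans h'
        simpa using this
  · rintro (rfl | ⟨i, hi, f, hf, h⟩)
    · exact one_mem _
    · obtain ⟨m, hm, i', hi', g', rfl, h'⟩ := key hi h
      exact mul_mem hm (Submonoid.subset_closure ((hL _).2 ⟨i', hi', f, hf, h'⟩))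

theorem singleton_of_mem {t : M} (ht : t ∈ T) : AcceptedWithLabels T ({t} : Set M) := by
  refine ⟨Bool, inferInstance, fun p q => {x | x = t ∧ p = false ∧ q = true}, {false}, {true},
    ?_, fun g => ?_⟩
  · rintro p q x ⟨rfl, _⟩; exact ht
  · constructor
    · rintro rfl; exact ⟨false, rfl, true, rfl, .edge ⟨rfl, rfl, rfl⟩⟩
    · rintro ⟨_, rfl, _, rfl, h⟩
      cases h with
      | snoc h hs =>
        obtain ⟨rfl, rfl, _⟩ := hs
        cases h with
        | nil => simp
        | snoc _ hs => exact absurd hs.2.2 (by simp)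

end AcceptedWithLabels

/-- Rational subsets of a monoid are accepted by finite graphs with labels in any set of generators
that contains `1`. -/
theorem IsRationalSubset.acceptedWithLabels {M : Type u} [Monoid M] {T : Set M} (h1 : 1 ∈ T)
    (hT : Submonoid.closure T = ⊤) {L : Set M} (hL : IsRationalSubset L) :
    AcceptedWithLabels T L := by
  have hsing : ∀ g : M, AcceptedWithLabels T {g} := fun g => by
    have hg : g ∈ Submonoid.closure T := hT ▸ Submonoid.mem_top g
    induction hg using Submonoid.closure_induction with
    | mem x hx => exact .singleton_of_mem hx
    | one => exact .one
    | mul x y _ _ hx hy => rw [← Set.singleton_mul_singleton]; exact hx.mul h1 hy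
  induction hL with
  | finite L hL =>
    induction L, hL using Set.Finite.induction_on with
    | empty => exact .empty
    | insert _ _ ih => exact (hsing _).union ih
  | union _ _ _ _ h₁ h₂ => exact h₁.union h₂
  | mul _ _ _ _ h₁ h₂ => exact h₁.mul h1 h₂
  | star _ _ h => exact h.star h1

/-! ### Pumping in free groups -/

/-- The elements of a free group given by words of length at most one. -/
def shortWords (α : Type u) : Set (FreeGroup α) :=
  {g | g = 1 ∨ ∃ x, g = FreeGroup.mk [x]}

theorem closure_shortWords (α : Type u) : Submonoid.closure (shortWords α) = ⊤ := by
  refine (Submonoid.eq_top_iff' _).2 fun g => ?_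
  classical
  rw [← FreeGroup.mk_toWord (x := g)]
  induction g.toWord with
  | nil => exact one_mem _
  | cons x L ih =>
    have : FreeGroup.mk (x :: L) = FreeGroup.mk [x] * FreeGroup.mk L := by simp
    rw [this]
    exact mul_mem (Submonoid.subset_closure (.inr ⟨x, rfl⟩)) ih

/-- A path reading a reduced word through the Cayley tree visits every prefix of that word. -/
theorem AutomatonPath.exists_split {α : Type u} {Q : Type} {E : Q → Q → Set (FreeGroup α)}
    (hE : ∀ p q, E p q ⊆ shortWords α) {p q : Q} {g : FreeGroup α} (h : AutomatonPath E p q g)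
    (U V : List (α × Bool)) (hUV : FreeGroup.IsReduced (U ++ V)) (hg : FreeGroup.mk (U ++ V) = g) :
    ∃ r, AutomatonPath E p r (FreeGroup.mk U) ∧ AutomatonPath E r q (FreeGroup.mk V) := by
  classical
  induction h generalizing V with
  | nil =>
    have h0 : U ++ V = [] := by
      have := hUV.reduce_eq
      rw [← FreeGroup.toWord_mk, hg, FreeGroup.toWord_one] at this
      exact this.symm
    obtain ⟨rfl, rfl⟩ := List.append_eq_nil_iff.1 h0
    exact ⟨p, .nil, .nil⟩
  | @snoc q r g s hp hs ih =>
    rcases hE _ _ hs with rfl | ⟨x, rfl⟩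
    · obtain ⟨t, h₁, h₂⟩ := ih V hUV (by simpa using hg)
      exact ⟨t, h₁, by simpa using h₂.snoc hs⟩
    rcases List.eq_nil_or_concat V with rfl | ⟨V, y, rfl⟩
    · refine ⟨r, ?_, .nil⟩
      rw [List.append_nil] at hg
      rw [hg]
      exact hp.snoc hs
    rw [List.concat_eq_append, ← List.append_assoc] at hUV hg
    by_cases hxy : y = x
    · subst hxy
      rw [← FreeGroup.mul_mk] at hg
      obtain ⟨t, h₁, h₂⟩ := ih V (hUV.infix (List.prefix_append _ _).isInfix) (mul_right_cancel hg)
      refine ⟨t, h₁, ?_⟩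
      rw [List.concat_eq_append, ← FreeGroup.mul_mk]
      exact h₂.snoc hs
    · have hx : FreeGroup.mk [(x.1, !x.2)] = (FreeGroup.mk [x])⁻¹ := by
        simp [FreeGroup.inv_mk, FreeGroup.invRev]
      have hred : FreeGroup.IsReduced (U ++ (V ++ [y] ++ [(x.1, !x.2)])) := by
        rw [← List.append_assoc, ← List.append_assoc]
        refine List.isChain_append.2 ⟨hUV, FreeGroup.IsReduced.singleton, ?_⟩
        simp only [List.getLast?_append, List.getLast?_singleton, Option.some_or, Option.mem_def,
          Option.some.injEq, List.head?_cons, forall_eq']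
        intro h1
        have h2 : y.2 ≠ x.2 := fun h2 => hxy (Prod.ext h1 h2)
        revert h2
        cases y.2 <;> cases x.2 <;> simp
      obtain ⟨t, h₁, h₂⟩ := ih (V ++ [y] ++ [(x.1, !x.2)]) hred (by
        rw [← List.append_assoc, ← List.append_assoc, ← FreeGroup.mul_mk, hg, hx]
        group)
      refine ⟨t, h₁, ?_⟩
      have := h₂.snoc hs
      rwa [← FreeGroup.mul_mk, hx, inv_mul_cancel_right, ← List.concat_eq_append] at this

/-- A path reading a long power `x ^ k` of a letter repeats a vertex, and inserting the loop once
more gives a path reading `x ^ (k + d)`. -/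
theorem AutomatonPath.exists_pump {α : Type u} {Q : Type} [Finite Q]
    {E : Q → Q → Set (FreeGroup α)} (hE : ∀ p q, E p q ⊆ shortWords α) (x : α × Bool) {p q : Q}
    {k : ℕ} (hk : Nat.card Q ≤ k)
    (h : AutomatonPath E p q (FreeGroup.mk (List.replicate k x))) :
    ∃ d, 0 < d ∧ d ≤ Nat.card Q ∧
      AutomatonPath E p q (FreeGroup.mk (List.replicate (k + d) x)) := by
  have hrep : ∀ m n : ℕ, FreeGroup.mk (List.replicate (m + n) x) =
      FreeGroup.mk (List.replicate m x) * FreeGroup.mk (List.replicate n x) := fun m n => by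
    rw [FreeGroup.mul_mk, List.replicate_append_replicate]
  have hred : ∀ n : ℕ, FreeGroup.IsReduced (List.replicate n x) := fun n =>
    List.isChain_replicate_of_rel _ fun _ => rfl
  -- The vertices `r 0, …, r k` are visited along the word; the last one is joined to `q` by a path
  -- with trivial label.
  obtain ⟨r, hr0, hr, hrk⟩ : ∃ r : ℕ → Q, r 0 = p ∧
      (∀ j < k, AutomatonPath E (r j) (r (j + 1)) (FreeGroup.mk (List.replicate 1 x))) ∧
      AutomatonPath E (r k) q 1 := by
    clear hk
    induction k generalizing p with
    | zero => exact ⟨fun _ => p, rfl, by simp, h⟩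
    | succ k ih =>
      have hsplit : List.replicate (k + 1) x = List.replicate 1 x ++ List.replicate k x := by
        rw [List.replicate_append_replicate, add_comm]
      obtain ⟨t, h₁, h₂⟩ := h.exists_split hE (List.replicate 1 x) (List.replicate k x)
        (hsplit ▸ hred (k + 1)) (by rw [hsplit])
      obtain ⟨r, rfl, hr, hrk⟩ := ih h₂
      refine ⟨fun j => Nat.casesOn j p r, rfl, fun j hj => ?_, hrk⟩
      cases j with
      | zero => exact h₁
      | succ j => exact hr j (by omega)
  have hseg : ∀ i n, i + n ≤ k →
      AutomatonPath E (r i) (r (i + n)) (FreeGroup.mk (List.replicate n x)) := fun i n => by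
    induction n with
    | zero => exact fun _ => .nil
    | succ n ih =>
      intro hn
      rw [hrep]
      exact (ih (by omega)).trans (hr (i + n) (by omega))
  obtain ⟨i, j, hij, hjM, heq⟩ : ∃ i j, i < j ∧ j ≤ Nat.card Q ∧ r i = r j := by
    have := Fintype.ofFinite Q
    obtain ⟨a, b, hab, h⟩ := Fintype.exists_ne_map_eq_of_card_lt
      (fun j : Fin (Nat.card Q + 1) => r j) (by simp [Nat.card_eq_fintype_card])
    rcases lt_or_gt_of_ne hab with hlt | hlt
    · exact ⟨a, b, hlt, by omega, h⟩
    · exact ⟨b, a, hlt, by omega, h.symm⟩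
  refine ⟨j - i, by omega, by omega, ?_⟩
  have h₁ := hseg 0 i (by omega)
  have h₂ := hseg i (j - i) (by omega)
  have h₃ := hseg i (k - i) (by omega)
  rw [Nat.add_sub_cancel' hij.le, ← heq] at h₂
  rw [Nat.add_sub_cancel' (by omega)] at h₃
  rw [zero_add, hr0] at h₁
  have := ((h₁.trans h₂).trans h₃).trans hrk
  rwa [mul_one, ← hrep, ← hrep, show i + (j - i) + (k - i) = k + (j - i) by omega] at this

/-- The word `a ^ k 0 b a ^ k 1 b ⋯ a ^ k (r - 1) b`, where `a` and `b` are the letters `true` and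
`false` of the alphabet `Bool`. -/
def syllableWord (k : ℕ → ℕ) : ℕ → List (Bool × Bool)
  | 0 => []
  | r + 1 => syllableWord k r ++ (List.replicate (k r) (true, true) ++ [(false, true)])

theorem syllableWord_congr {k k' : ℕ → ℕ} {r : ℕ} (h : ∀ i < r, k i = k' i) :
    syllableWord k r = syllableWord k' r := by
  induction r with
  | zero => rfl
  | succ r ih => rw [syllableWord, syllableWord, ih fun i hi => h i (by omega), h r (by omega)]

theorem snd_of_mem_syllableWord {k : ℕ → ℕ} {r : ℕ} {x : Bool × Bool}
    (hx : x ∈ syllableWord k r) : x.2 = true := by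
  induction r with
  | zero => simp [syllableWord] at hx
  | succ r ih =>
    simp only [syllableWord, List.mem_append, List.mem_replicate, List.mem_singleton] at hx
    rcases hx with hx | ⟨_, rfl⟩ | rfl
    exacts [ih hx, rfl, rfl]

theorem isReduced_syllableWord (k : ℕ → ℕ) (r : ℕ) : FreeGroup.IsReduced (syllableWord k r) :=
  List.Pairwise.isChain (List.pairwise_of_forall_mem_list fun _ hx _ hy _ =>
    (snd_of_mem_syllableWord hx).trans (snd_of_mem_syllableWord hy).symm)

/-- All the powers of `a` in `syllableWord k r` can be pumped independently. -/
theorem AutomatonPath.exists_pump_syllableWord {Q : Type} [Finite Q]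
    {E : Q → Q → Set (FreeGroup Bool)} (hE : ∀ p q, E p q ⊆ shortWords Bool) {k : ℕ → ℕ}
    (hk : ∀ i, Nat.card Q ≤ k i) (r : ℕ) {p q : Q}
    (h : AutomatonPath E p q (FreeGroup.mk (syllableWord k r))) :
    ∃ k' : ℕ → ℕ, (∀ i < r, k i < k' i ∧ k' i ≤ k i + Nat.card Q) ∧
      AutomatonPath E p q (FreeGroup.mk (syllableWord k' r)) := by
  induction r generalizing q with
  | zero => exact ⟨k, by simp, h⟩
  | succ r ih =>
    have hred := isReduced_syllableWord k (r + 1)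
    obtain ⟨t, h₁, h₂⟩ := h.exists_split hE _ _ hred rfl
    obtain ⟨t', h₂, h₃⟩ := h₂.exists_split hE _ _
      (hred.infix (List.suffix_append _ _).isInfix) rfl
    obtain ⟨k', hk', h₁⟩ := ih h₁
    obtain ⟨d, hd0, hd, h₂⟩ := h₂.exists_pump hE _ (hk r)
    refine ⟨Function.update k' r (k r + d), fun i hi => ?_, ?_⟩
    · rcases Nat.lt_succ_iff_lt_or_eq.1 hi with hi | rfl
      · rw [Function.update_of_ne hi.ne]; exact hk' i hi
      · rw [Function.update_self]; omega
    · rw [syllableWord, syllableWord_congr (k' := k') fun i hi => Function.update_of_ne hi.ne _ _,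
        Function.update_self, ← FreeGroup.mul_mk, ← FreeGroup.mul_mk]
      exact h₁.trans (h₂.trans h₃)

/-! ### Counting syllables -/

/-- For a word `L` in the letters `a = true` and `b = false`, the sum of `δ m` over the maximal
`a`-syllables `a ^ m` of the word `a ^ e * L * a ^ f`, cut at each occurrence of `b` or `b⁻¹`.
Empty syllables count as `δ 0`. -/
def syllableSum {A : Type u} [AddCommGroup A] (δ : ℤ → A) (f : ℤ) : ℤ → List (Bool × Bool) → A
  | e, [] => δ (e + f)
  | e, (true, ε) :: L => syllableSum δ f (e + if ε then 1 else -1) L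
  | e, (false, _) :: L => δ e + syllableSum δ f 0 L

section SyllableSum

variable {A : Type u} [AddCommGroup A] (δ : ℤ → A)

theorem syllableSum_concat_true (f e : ℤ) (L : List (Bool × Bool)) (ε : Bool) :
    syllableSum δ f e (L ++ [(true, ε)]) = syllableSum δ (f + if ε then 1 else -1) e L := by
  induction L generalizing e with
  | nil => simp only [List.nil_append, syllableSum]; congr 1; ring
  | cons x L ih =>
    obtain ⟨_ | _, η⟩ := x <;> simp only [List.cons_append, syllableSum, ih]

theorem syllableSum_concat_false (f e : ℤ) (L : List (Bool × Bool)) (ε : Bool) :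
    syllableSum δ f e (L ++ [(false, ε)]) = syllableSum δ 0 e L + δ f := by
  induction L generalizing e with
  | nil => simp [syllableSum]
  | cons x L ih =>
    obtain ⟨_ | _, η⟩ := x <;> simp only [List.cons_append, syllableSum, ih, add_assoc]

theorem syllableSum_append_replicate (f e : ℤ) (L : List (Bool × Bool)) (k : ℕ) :
    syllableSum δ f e (L ++ List.replicate k (true, true)) = syllableSum δ (f + k) e L := by
  induction k generalizing f with
  | zero => simp
  | succ k ih =>
    rw [List.replicate_succ', ← List.append_assoc, syllableSum_concat_true, ih]
    congr 1; push_cast; simp; ring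

variable {δ}

theorem syllableSum_invRev (hδ : ∀ m, δ (-m) = -δ m) (f e : ℤ) (L : List (Bool × Bool)) :
    syllableSum δ (-e) (-f) (FreeGroup.invRev L) = -syllableSum δ f e L := by
  induction L generalizing e with
  | nil => simp only [FreeGroup.invRev_empty, syllableSum, ← hδ]; congr 1; ring
  | cons x L ih =>
    have : FreeGroup.invRev (x :: L) = FreeGroup.invRev L ++ [(x.1, !x.2)] := by
      simp [FreeGroup.invRev]
    rw [this]
    obtain ⟨_ | _, η⟩ := x
    · rw [syllableSum_concat_false, syllableSum, hδ, ← neg_zero, ih, neg_zero]; abel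
    · rw [syllableSum_concat_true, syllableSum, ← ih]
      congr 1
      cases η <;> simp <;> ring

theorem exists_syllableSum_sub (f e e' : ℤ) (L : List (Bool × Bool)) :
    ∃ j, syllableSum δ f e L - syllableSum δ f e' L = δ (e + j) - δ (e' + j) := by
  induction L generalizing e e' with
  | nil => exact ⟨f, rfl⟩
  | cons x L ih =>
    obtain ⟨_ | _, η⟩ := x
    · exact ⟨0, by simp [syllableSum]⟩
    · obtain ⟨j, hj⟩ := ih (e + if η then 1 else -1) (e' + if η then 1 else -1)
      exact ⟨_, by rw [syllableSum, syllableSum, hj, add_assoc, add_assoc]⟩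

/-- Concatenation changes the sum over syllables only at the syllable through the joint. -/
theorem exists_syllableSum_append (e : ℤ) (L₁ L₂ : List (Bool × Bool)) :
    ∃ i j, syllableSum δ 0 e (L₁ ++ L₂) =
      syllableSum δ 0 e L₁ + syllableSum δ 0 0 L₂ + (δ (i + j) - δ i - δ j) := by
  induction L₁ generalizing e with
  | nil =>
    obtain ⟨j, hj⟩ := exists_syllableSum_sub (δ := δ) 0 e 0 L₂
    rw [sub_eq_iff_eq_add] at hj
    refine ⟨e, j, ?_⟩
    rw [List.nil_append, hj, syllableSum, zero_add, add_zero]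
    abel
  | cons x L ih =>
    obtain ⟨_ | _, η⟩ := x
    · obtain ⟨i, j, h⟩ := ih 0
      exact ⟨i, j, by rw [List.cons_append, syllableSum, syllableSum, h]; abel⟩
    · obtain ⟨i, j, h⟩ := ih (e + if η then 1 else -1)
      exact ⟨i, j, by rw [List.cons_append, syllableSum, syllableSum, h]⟩

theorem syllableSum_syllableWord (h0 : δ 0 = 0) (k : ℕ → ℕ) (r : ℕ) :
    syllableSum δ 0 0 (syllableWord k r) = ∑ i ∈ Finset.range r, δ (k i) := by
  induction r with
  | zero => simpa [syllableWord, syllableSum] using h0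
  | succ r ih =>
    have h : ∀ f, syllableSum δ f 0 (syllableWord k r) =
        ∑ i ∈ Finset.range r, δ (k i) + δ f := fun f => by
      cases r with
      | zero => simp [syllableWord, syllableSum]
      | succ r =>
        rw [syllableWord, ← List.append_assoc, syllableSum_concat_false] at ih ⊢
        rw [← ih, h0, add_zero]
    rw [syllableWord, ← List.append_assoc, syllableSum_concat_false, syllableSum_append_replicate,
      h, Finset.sum_range_succ, h0, zero_add, add_zero]

end SyllableSum

theorem FreeGroup.exists_cancellation {α : Type u} (L₁ L₂ : List (α × Bool))
    (h₁ : FreeGroup.IsReduced L₁) (h₂ : FreeGroup.IsReduced L₂) :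
    ∃ U C V, L₁ = U ++ C ∧ L₂ = FreeGroup.invRev C ++ V ∧ FreeGroup.IsReduced (U ++ V) := by
  induction L₁ using List.reverseRecOn generalizing L₂ with
  | nil => exact ⟨[], [], L₂, rfl, rfl, h₂⟩
  | append_singleton L x ih =>
    by_cases hred : FreeGroup.IsReduced (L ++ [x] ++ L₂)
    · exact ⟨L ++ [x], [], L₂, by simp, rfl, hred⟩
    rcases L₂ with _ | ⟨y, L₂⟩
    · exact absurd (by simpa using h₁) hred
    have hxy : y = (x.1, !x.2) := by
      by_contra hne
      refine hred (List.isChain_append.2 ⟨h₁, h₂, ?_⟩)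
      simp only [List.getLast?_append, List.getLast?_singleton, Option.some_or, Option.mem_def,
        Option.some.injEq, List.head?_cons, forall_eq']
      intro h
      by_contra h'
      refine hne (Prod.ext h.symm ?_)
      revert h'
      cases x.2 <;> cases y.2 <;> simp
    subst hxy
    obtain ⟨U, C, V, rfl, rfl, h⟩ := ih L₂ (h₁.infix (List.prefix_append _ _).isInfix)
      (h₂.infix (List.suffix_cons _ _).isInfix)
    exact ⟨U, C ++ [x], V, by simp, by simp [FreeGroup.invRev], h⟩

/-! ### The syllable count as a quasi-homomorphism -/

/-- The odd function `m ↦ [m] - [-m]` from `ℤ` to the finitely supported functions. -/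
noncomputable def signedSingle (n : ℕ) (m : ℤ) : ℤ →₀ ZMod n :=
  Finsupp.single m 1 - Finsupp.single (-m) 1

theorem signedSingle_neg (n : ℕ) (m : ℤ) : signedSingle n (-m) = -signedSingle n m := by
  simp [signedSingle]

theorem signedSingle_zero (n : ℕ) : signedSingle n 0 = 0 := by simp [signedSingle]

section SupportCard

variable {n : ℕ}

theorem card_support_add_le (x y : ℤ →₀ ZMod n) :
    (x + y).support.card ≤ x.support.card + y.support.card :=
  (Finset.card_le_card Finsupp.support_add).trans (Finset.card_union_le _ _)

theorem card_support_sub_le (x y : ℤ →₀ ZMod n) :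
    (x - y).support.card ≤ x.support.card + y.support.card := by
  simpa [sub_eq_add_neg, Finsupp.support_neg] using card_support_add_le x (-y)

theorem card_support_signedSingle_le (m : ℤ) : (signedSingle n m).support.card ≤ 2 :=
  (card_support_sub_le _ _).trans (add_le_add
    ((Finset.card_le_card Finsupp.support_single_subset).trans (Finset.card_singleton _).le)
    ((Finset.card_le_card Finsupp.support_single_subset).trans (Finset.card_singleton _).le))

theorem card_support_signedSingle_defect_le (i j : ℤ) :
    (signedSingle n (i + j) - signedSingle n i - signedSingle n j).support.card ≤ 6 := by
  have h₁ := card_support_sub_le (signedSingle n (i + j) - signedSingle n i) (signedSingle n j)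
  have h₂ := card_support_sub_le (signedSingle n (i + j)) (signedSingle n i)
  have h := card_support_signedSingle_le (n := n)
  have := h (i + j); have := h i; have := h j
  omega

end SupportCard

/-- The coefficient at `m` is, modulo `n`, the number of syllables `a ^ m` minus the number of
syllables `a ^ (-m)` of the reduced word of `g`. -/
noncomputable def syllableCount (n : ℕ) (g : FreeGroup Bool) : ℤ →₀ ZMod n :=
  syllableSum (signedSingle n) 0 0 g.toWord

section SyllableCount

variable {n : ℕ}

theorem syllableCount_mk {L : List (Bool × Bool)} (hL : FreeGroup.IsReduced L) :
    syllableCount n (FreeGroup.mk L) = syllableSum (signedSingle n) 0 0 L := by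
  rw [syllableCount, FreeGroup.toWord_mk, hL.reduce_eq]

theorem syllableCount_one : syllableCount n 1 = 0 := by
  simp [syllableCount, syllableSum, signedSingle_zero]

theorem syllableCount_inv (g : FreeGroup Bool) : syllableCount n g⁻¹ = -syllableCount n g := by
  have := syllableSum_invRev (signedSingle_neg n) 0 0 g.toWord
  rwa [neg_zero, ← FreeGroup.toWord_inv] at this

theorem card_support_syllableCount_mul_le (g h : FreeGroup Bool) :
    (syllableCount n (g * h) - syllableCount n g - syllableCount n h).support.card ≤ 18 := by
  obtain ⟨U, C, V, hg, hh, hUV⟩ := FreeGroup.exists_cancellation g.toWord h.toWord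
    FreeGroup.isReduced_toWord FreeGroup.isReduced_toWord
  have hgh : g * h = FreeGroup.mk (U ++ V) := by
    rw [← FreeGroup.mk_toWord (x := g), ← FreeGroup.mk_toWord (x := h), hg, hh,
      ← FreeGroup.mul_mk, ← FreeGroup.mul_mk, ← FreeGroup.mul_mk, ← FreeGroup.inv_mk]
    group
  obtain ⟨i₁, j₁, h₁⟩ := exists_syllableSum_append (δ := signedSingle n) 0 U V
  obtain ⟨i₂, j₂, h₂⟩ := exists_syllableSum_append (δ := signedSingle n) 0 U C
  obtain ⟨i₃, j₃, h₃⟩ :=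
    exists_syllableSum_append (δ := signedSingle n) 0 (FreeGroup.invRev C) V
  have hC := syllableSum_invRev (signedSingle_neg n) 0 0 C
  rw [neg_zero] at hC
  have key : syllableCount n (g * h) - syllableCount n g - syllableCount n h =
      (signedSingle n (i₁ + j₁) - signedSingle n i₁ - signedSingle n j₁) -
      (signedSingle n (i₂ + j₂) - signedSingle n i₂ - signedSingle n j₂) -
      (signedSingle n (i₃ + j₃) - signedSingle n i₃ - signedSingle n j₃) := by
    rw [hgh, syllableCount_mk hUV, syllableCount, syllableCount, hg, hh, h₁, h₂, h₃, hC]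
    abel
  rw [key]
  have d := card_support_signedSingle_defect_le (n := n)
  have := d i₁ j₁; have := d i₂ j₂; have := d i₃ j₃
  refine (card_support_sub_le _ _).trans ?_
  have := card_support_sub_le (signedSingle n (i₁ + j₁) - signedSingle n i₁ - signedSingle n j₁)
    (signedSingle n (i₂ + j₂) - signedSingle n i₂ - signedSingle n j₂)
  omega

/-- On the values of a word `w`, the syllable count agrees with the value of `w` in an abelian
group, up to an error with support bounded in terms of `w`. -/
theorem exists_card_support_syllableCount_lift_le (w : GroupWord) :
    ∃ C, ∀ f : ℕ → FreeGroup Bool, (syllableCount n (FreeGroup.lift f w) - Multiplicative.toAdd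
      (FreeGroup.lift (fun i => Multiplicative.ofAdd (syllableCount n (f i))) w)).support.card
        ≤ C := by
  induction w using FreeGroup.induction_on with
  | C1 => exact ⟨0, fun f => by simp [syllableCount_one]⟩
  | of i => exact ⟨0, fun f => by simp⟩
  | inv_of i _ => exact ⟨0, fun f => by simp [syllableCount_inv]⟩
  | mul x y hx hy =>
    obtain ⟨C₁, h₁⟩ := hx
    obtain ⟨C₂, h₂⟩ := hy
    refine ⟨18 + (C₁ + C₂), fun f => ?_⟩
    specialize h₁ f
    specialize h₂ f
    rw [map_mul, map_mul, toAdd_mul]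
    refine le_trans ?_ (add_le_add (card_support_syllableCount_mul_le (n := n)
      (FreeGroup.lift f x) (FreeGroup.lift f y)) (add_le_add h₁ h₂))
    refine le_trans (le_of_eq ?_) ((card_support_add_le _ _).trans
      (add_le_add_right (card_support_add_le _ _) _))
    congr 2
    abel

end SyllableCount

/-! ### Words, their values and proper words -/

theorem map_lift_eq {α : Type u} {G H : Type*} [Group G] [Group H] (φ : G →* H) (f : α → G)
    (w : FreeGroup α) : φ (FreeGroup.lift f w) = FreeGroup.lift (fun i => φ (f i)) w :=
  DFunLike.congr_fun (FreeGroup.ext_hom (f := φ.comp (FreeGroup.lift f))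
    (g := FreeGroup.lift fun i => φ (f i)) (by simp)) w

theorem IsRationalSubset.image {M : Type u} {N : Type v} [Monoid M] [Monoid N] (φ : M →* N)
    {L : Set M} (hL : IsRationalSubset L) : IsRationalSubset (φ '' L) := by
  induction hL with
  | finite L hL => exact .finite _ (hL.image φ)
  | union _ _ _ _ h₁ h₂ => rw [Set.image_union]; exact h₁.union _ _ h₂
  | mul _ _ _ _ h₁ h₂ => rw [Set.image_mul]; exact h₁.mul _ _ h₂
  | star L _ h =>
    rw [← Submonoid.coe_map, MonoidHom.map_mclosure]
    exact h.star _

theorem verbalSet_eq_image {H : Type u} {G : Type v} [Group H] [Group G] {φ : H →* G}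
    (hφ : Function.Surjective φ) (w : GroupWord) : verbalSet w G = φ '' verbalSet w H := by
  ext g
  constructor
  · rintro ⟨f, rfl⟩
    refine ⟨_, ⟨fun i => Function.surjInv hφ (f i), rfl⟩, ?_⟩
    rw [map_lift_eq]
    simp only [Function.surjInv_eq hφ]
  · rintro ⟨_, ⟨f, rfl⟩, rfl⟩
    exact ⟨fun i => φ (f i), (map_lift_eq φ f w).symm⟩

theorem not_isRationalSubset_verbalSet_of_surjective {H : Type u} {G : Type v} [Group H] [Group G]
    {φ : H →* G} (hφ : Function.Surjective φ) {w : GroupWord}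
    (h : ¬ IsRationalSubset (verbalSet w G)) : ¬ IsRationalSubset (verbalSet w H) :=
  fun hw => h (verbalSet_eq_image hφ w ▸ hw.image φ)

theorem conj_mem_verbalSet {G : Type u} [Group G] {w : GroupWord} {g : G} (hg : g ∈ verbalSet w G)
    (h : G) : h * g * h⁻¹ ∈ verbalSet w G := by
  obtain ⟨f, rfl⟩ := hg
  exact ⟨_, (map_lift_eq (MulAut.conj h).toMonoidHom f w).symm⟩

theorem IsProperWord.ne_one {w : GroupWord} (hw : IsProperWord.{p} w) : w ≠ 1 := by
  rintro rfl
  obtain ⟨⟨G, _, hG⟩, -⟩ := hw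
  refine hG (Set.ext fun g => ?_)
  simp [verbalSet, eq_comm]

/-- The values of a word in `ℤ` form the subgroup generated by the exponent sums of its letters;
if `1` is a value, then every element of every group is a value. -/
theorem IsProperWord.exists_dvd {w : GroupWord} (hw : IsProperWord.{p} w) :
    ∃ n : ℕ, 2 ≤ n ∧ ∀ c : ℕ → ℤ, (n : ℤ) ∣
      Multiplicative.toAdd (FreeGroup.lift (fun i => Multiplicative.ofAdd (c i)) w) := by
  let e : (ℕ → ℤ) →+ ℤ :=
    AddMonoidHom.mk'
      (fun c => Multiplicative.toAdd (FreeGroup.lift (fun i => Multiplicative.ofAdd (c i)) w))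
      fun c d => by
      clear hw
      induction w using FreeGroup.induction_on with
      | C1 => simp
      | of i => simp
      | inv_of i _ => simp [add_comm]
      | mul x y hx hy => simp only [map_mul, toAdd_mul, hx, hy]; abel
  have he : ∀ c, e c ≠ 1 := by
    intro c hc
    obtain ⟨-, H, _, hH⟩ := hw
    refine hH (Set.eq_univ_of_forall fun h => ⟨fun i => h ^ c i, ?_⟩)
    have := map_lift_eq (zpowersHom H h) (fun i => Multiplicative.ofAdd (c i)) w
    simp only [zpowersHom_apply, toAdd_ofAdd] at this
    rw [← this]
    change h ^ e c = h
    rw [hc, zpow_one]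
  obtain ⟨a, ha⟩ := Int.subgroup_cyclic e.range
  have hdvd : ∀ c, a ∣ e c := fun c => by
    have : e c ∈ AddSubgroup.closure {a} := ha ▸ ⟨c, rfl⟩
    exact Int.mem_zmultiples_iff.1 (AddSubgroup.zmultiples_eq_closure a ▸ this)
  obtain ⟨c₀, hc₀⟩ : a ∈ e.range := ha ▸ AddSubgroup.subset_closure rfl
  by_cases h0 : a = 0
  · exact ⟨2, le_rfl, fun c => by
      have : e c = 0 := zero_dvd_iff.1 (h0 ▸ hdvd c)
      exact this ▸ dvd_zero _⟩
  · refine ⟨a.natAbs, ?_, fun c => Int.natAbs_dvd.2 (hdvd c)⟩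
    have h1 : a ≠ 1 := hc₀ ▸ he c₀
    have h2 : a ≠ -1 := fun h => he (-c₀) (by rw [map_neg, hc₀, h, neg_neg])
    omega

/-- A word whose exponent sums are divisible by `n` is trivial in abelian groups of exponent `n`. -/
theorem lift_ofAdd_eq_zero_of_dvd {w : GroupWord} {n : ℕ}
    (hn : ∀ c : ℕ → ℤ, (n : ℤ) ∣
      Multiplicative.toAdd (FreeGroup.lift (fun i => Multiplicative.ofAdd (c i)) w))
    (u : ℕ → ℤ →₀ ZMod n) :
    Multiplicative.toAdd (FreeGroup.lift (fun i => Multiplicative.ofAdd (u i)) w) = 0 := by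
  ext j
  choose c hc using fun i => ZMod.intCast_surjective (u i j)
  have h₁ := map_lift_eq (AddMonoidHom.toMultiplicative (Finsupp.applyAddHom (M := ZMod n) j))
    (fun i => Multiplicative.ofAdd (u i)) w
  have h₂ := map_lift_eq (AddMonoidHom.toMultiplicative (Int.castAddHom (ZMod n)))
    (fun i => Multiplicative.ofAdd (c i)) w
  have h₃ : (fun i => AddMonoidHom.toMultiplicative (Finsupp.applyAddHom (M := ZMod n) j)
        (Multiplicative.ofAdd (u i))) =
      fun i => AddMonoidHom.toMultiplicative (Int.castAddHom (ZMod n))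
        (Multiplicative.ofAdd (c i)) := funext fun i => congrArg Multiplicative.ofAdd (hc i).symm
  rw [h₃, ← h₂] at h₁
  exact (congrArg Multiplicative.toAdd h₁).trans ((ZMod.intCast_zmod_eq_zero_iff_dvd _ _).2 (hn c))

/-- The conjugates `b ^ i * a * b ^ (-i)` generate freely: they are the generators `i ∈ ℤ` of the
normal factor of the semidirect product of `FreeGroup ℤ` by the shift. -/
theorem injective_lift_conj : Function.Injective
    (FreeGroup.lift fun i : ℕ => FreeGroup.of false ^ i * FreeGroup.of true *
      (FreeGroup.of false ^ i)⁻¹ : FreeGroup ℕ → FreeGroup Bool) := by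
  let σ : MulAut (FreeGroup ℤ) := FreeGroup.freeGroupCongr (Equiv.addRight 1)
  let θ : FreeGroup Bool →* FreeGroup ℤ ⋊[zpowersHom _ σ] Multiplicative ℤ :=
    FreeGroup.lift fun x => if x then .inl (FreeGroup.of 0) else .inr (Multiplicative.ofAdd 1)
  have hσ : ∀ i : ℕ, (σ ^ i) (FreeGroup.of 0) = FreeGroup.of (i : ℤ) := fun i => by
    induction i with
    | zero => simp
    | succ i ih => rw [pow_succ', MulAut.mul_apply, ih]; simp [σ]
  have hθ : ∀ x, θ (FreeGroup.lift (fun i : ℕ => FreeGroup.of false ^ i * FreeGroup.of true *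
      (FreeGroup.of false ^ i)⁻¹) x) = SemidirectProduct.inl (FreeGroup.map Nat.cast x) := by
    intro x
    rw [map_lift_eq, ← MonoidHom.comp_apply]
    refine DFunLike.congr_fun (FreeGroup.ext_hom _ _ fun i => ?_) x
    have := SemidirectProduct.inl_aut (φ := zpowersHom _ σ) (Multiplicative.ofAdd (i : ℤ))
      (FreeGroup.of 0)
    rw [zpowersHom_apply, toAdd_ofAdd, zpow_natCast, hσ] at this
    simp only [FreeGroup.lift_apply_of, MonoidHom.comp_apply, FreeGroup.map.of, this, map_mul,
      map_inv, map_pow, θ, if_true]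
    simp [← map_pow, ← ofAdd_nsmul]
  intro x y hxy
  have := (hθ x).symm.trans ((congrArg θ hxy).trans (hθ y))
  exact FreeGroup.map_injective Nat.cast_injective (SemidirectProduct.inl_injective this)

/-! ### Verbal subsets of free groups are not rational -/

theorem exists_isCyclicallyReduced_mk_mem_verbalSet {w : GroupWord} (hw : w ≠ 1) :
    ∃ G, G ≠ [] ∧ FreeGroup.IsCyclicallyReduced G ∧
      FreeGroup.mk G ∈ verbalSet w (FreeGroup Bool) := by
  obtain ⟨g, hg, hg1⟩ : ∃ g ∈ verbalSet w (FreeGroup Bool), g ≠ 1 :=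
    ⟨_, ⟨_, rfl⟩, fun h => hw (injective_lift_conj (h.trans (map_one _).symm))⟩
  have hconj := congrArg FreeGroup.mk
    (FreeGroup.reduceCyclically.conj_conjugator_reduceCyclically g.toWord)
  rw [FreeGroup.mk_toWord, ← FreeGroup.mul_mk, ← FreeGroup.mul_mk, ← FreeGroup.inv_mk] at hconj
  refine ⟨FreeGroup.reduceCyclically g.toWord, fun h0 => hg1 ?_,
    FreeGroup.reduceCyclically.isCyclicallyReduced FreeGroup.isReduced_toWord, ?_⟩
  · rw [← hconj, h0, ← FreeGroup.one_eq_mk, mul_one, mul_inv_cancel]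
  · have := conj_mem_verbalSet hg
      (FreeGroup.mk (FreeGroup.reduceCyclically.conjugator g.toWord))⁻¹
    rw [mul_inv_eq_iff_eq_mul, ← eq_inv_mul_iff_mul_eq, ← mul_assoc] at hconj
    rwa [inv_inv, ← hconj] at this

theorem FreeGroup.IsReduced.invRev {α : Type u} {L : List (α × Bool)}
    (hL : FreeGroup.IsReduced L) : FreeGroup.IsReduced (FreeGroup.invRev L) := by
  classical
  rw [FreeGroup.isReduced_iff_reduce_eq] at hL ⊢
  rw [FreeGroup.reduce_invRev, hL]

/-- A nonempty cyclically reduced word `G` has a letter `c` such that no cancellation occurs in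
`h⁻¹ * G * h` for `h = c * a ^ k 0 * b * a ^ k 1 * b ⋯`: of the four letters, at most three are
excluded by the first letter of `G`, its last letter and the syllable that follows. -/
theorem exists_isReduced_conj_syllableWord {G : List (Bool × Bool)} (hne : G ≠ [])
    (hG : FreeGroup.IsCyclicallyReduced G) :
    ∃ c : Bool × Bool, ∀ (k : ℕ → ℕ) (r : ℕ), (∀ i, 0 < k i) →
      FreeGroup.IsReduced (FreeGroup.invRev (c :: syllableWord k r) ++ G ++ [c] ++
        syllableWord k r) := by
  obtain ⟨s, hs⟩ : ∃ s, G.head? = some s := ⟨_, List.head?_eq_some_head hne⟩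
  obtain ⟨t, ht⟩ : ∃ t, G.getLast? = some t := ⟨_, List.getLast?_eq_some_getLast hne⟩
  have hts : t.1 = s.1 → t.2 = s.2 := hG.2 t ht s hs
  obtain ⟨c, hcs, hct, hca⟩ : ∃ c : Bool × Bool, (c.1 = s.1 → (!c.2) = s.2) ∧
      (t.1 = c.1 → t.2 = c.2) ∧ (c.1 = true → c.2 = true) := by
    clear hs ht
    revert s t
    decide
  refine ⟨c, fun k r hk => ?_⟩
  have hhead : ∀ y ∈ (syllableWord k r).head?, y = (true, true) := by
    intro y hy
    induction r with
    | zero => simp [syllableWord] at hy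
    | succ r ih =>
      rw [syllableWord] at hy
      rcases h : syllableWord k r with _ | ⟨z, L⟩
      · obtain ⟨m, hm⟩ := Nat.exists_eq_succ_of_ne_zero (hk r).ne'
        rw [h, hm] at hy
        simpa [List.replicate_succ, eq_comm] using hy
      · rw [h] at hy ih
        exact ih (by simpa using hy)
  have hcW : FreeGroup.IsReduced (c :: syllableWord k r) := by
    refine List.isChain_cons.2 ⟨fun y hy => ?_, isReduced_syllableWord k r⟩
    rw [hhead y hy]
    exact hca
  rw [List.append_assoc, List.append_assoc, List.singleton_append]
  refine List.isChain_append.2 ⟨hcW.invRev, List.isChain_append.2 ⟨hG.1, hcW, ?_⟩, ?_⟩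
  · intro x hx y hy
    rw [ht, Option.mem_some_iff] at hx
    rw [List.head?_cons, Option.mem_some_iff] at hy
    subst hx hy
    exact hct
  · intro x hx y hy
    rw [List.head?_append, hs, Option.some_or, Option.mem_some_iff] at hy
    have hinv : FreeGroup.invRev (c :: syllableWord k r) =
        FreeGroup.invRev (syllableWord k r) ++ [(c.1, !c.2)] := by simp [FreeGroup.invRev]
    rw [hinv, List.getLast?_append, List.getLast?_singleton, Option.some_or,
      Option.mem_some_iff] at hx
    subst hx hy
    exact hcs

/-- Distinct syllable lengths `k i` that are not among the lengths `k' j` all contribute to the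
difference of the syllable counts. -/
theorem le_card_support_sum_signedSingle {n : ℕ} (hn : 2 ≤ n) {k k' : ℕ → ℕ} {r : ℕ}
    (hinj : Function.Injective k) (hk : ∀ i, 0 < k i) (hne : ∀ i, ∀ j < r, k' j ≠ k i) :
    r ≤ (∑ i ∈ Finset.range r, signedSingle n (k' i) -
      ∑ i ∈ Finset.range r, signedSingle n (k i)).support.card := by
  have : Fact (1 < n) := ⟨hn⟩
  have hsub : (Finset.range r).image (fun i => (k i : ℤ)) ⊆
      (∑ i ∈ Finset.range r, signedSingle n (k' i) -
        ∑ i ∈ Finset.range r, signedSingle n (k i)).support := by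
    intro m hm
    obtain ⟨i, hi, rfl⟩ := Finset.mem_image.1 hm
    have h₁ : ∀ j ∈ Finset.range r, signedSingle n (k' j) (k i) = 0 := fun j hj => by
      have := hne i j (Finset.mem_range.1 hj)
      have := hk i
      rw [signedSingle, Finsupp.sub_apply, Finsupp.single_eq_of_ne (by omega),
        Finsupp.single_eq_of_ne (by omega), sub_zero]
    have h₂ : ∀ j, signedSingle n (k j) (k i) = if j = i then 1 else 0 := fun j => by
      have := hk i
      rw [signedSingle, Finsupp.sub_apply, Finsupp.single_eq_of_ne (a := -(k j : ℤ)) (by omega),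
        sub_zero, Finsupp.single_apply]
      simp [hinj.eq_iff]
    rw [Finsupp.mem_support_iff, Finsupp.sub_apply, Finsupp.finsetSum_apply,
      Finsupp.finsetSum_apply, Finset.sum_eq_zero h₁]
    simp only [h₂]
    rw [Finset.sum_ite_eq', if_pos hi]
    simp
  have := Finset.card_le_card hsub
  rwa [Finset.card_image_of_injective _ fun i j h => hinj (Nat.cast_injective h),
    Finset.card_range] at this

/-- If `w[F₂]` were accepted by a finite graph, pumping the second half of the value
`h⁻¹ * G * h` would give values `h⁻¹ * G * h'` with unbounded syllable counts modulo `n`, where `n`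
divides all exponent sums of `w`. -/
theorem not_isRationalSubset_verbalSet_freeGroup_bool {w : GroupWord} (hw : IsProperWord.{p} w) :
    ¬ IsRationalSubset (verbalSet w (FreeGroup Bool)) := by
  intro hrat
  obtain ⟨n, hn, hdvd⟩ := hw.exists_dvd
  obtain ⟨C, hC⟩ := exists_card_support_syllableCount_lift_le (n := n) w
  have hbound : ∀ g ∈ verbalSet w (FreeGroup Bool), (syllableCount n g).support.card ≤ C := by
    rintro _ ⟨f, rfl⟩
    have := hC f
    rwa [lift_ofAdd_eq_zero_of_dvd hdvd, sub_zero] at this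
  obtain ⟨G, hne, hG, hGw⟩ := exists_isCyclicallyReduced_mk_mem_verbalSet hw.ne_one
  obtain ⟨c, hc⟩ := exists_isReduced_conj_syllableWord hne hG
  obtain ⟨Q, _, E, I, F, hE, hL⟩ := hrat.acceptedWithLabels (.inl rfl) (closure_shortWords Bool)
  -- Take `k i = (i + 1) (M + 1)`: pumping adds at most `M`, so pumped lengths avoid all the `k i`.
  obtain ⟨M, hM⟩ : ∃ M, M = Nat.card Q := ⟨_, rfl⟩
  let k : ℕ → ℕ := fun i => (i + 1) * (M + 1)
  have hkM : ∀ i, M < k i := fun i => Nat.le_mul_of_pos_left _ i.succ_pos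
  have hkpos : ∀ i, 0 < k i := fun i => (Nat.zero_le M).trans_lt (hkM i)
  have hkinj : Function.Injective k := fun i j hij => by
    have := Nat.eq_of_mul_eq_mul_right M.succ_pos hij
    omega
  let z : FreeGroup Bool := (FreeGroup.mk [c])⁻¹ * FreeGroup.mk G * FreeGroup.mk [c]
  obtain ⟨r, hrC⟩ : ∃ r, r = C + (syllableCount n z).support.card + 37 := ⟨_, rfl⟩
  let U := FreeGroup.invRev (c :: syllableWord k r) ++ G ++ [c]
  have hU : FreeGroup.mk U = (FreeGroup.mk (syllableWord k r))⁻¹ * z := by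
    have : c :: syllableWord k r = [c] ++ syllableWord k r := rfl
    simp only [U, z, this, ← FreeGroup.mul_mk, ← FreeGroup.inv_mk, mul_inv_rev, mul_assoc]
  have hx : FreeGroup.mk (U ++ syllableWord k r) ∈ verbalSet w (FreeGroup Bool) := by
    have := conj_mem_verbalSet hGw (FreeGroup.mk (c :: syllableWord k r))⁻¹
    rw [inv_inv] at this
    convert this using 1
    simp only [U, FreeGroup.inv_mk, FreeGroup.mul_mk, List.append_assoc, List.singleton_append]
  obtain ⟨i, hi, f, hf, hpath⟩ := (hL _).1 hx
  obtain ⟨t, h₁, h₂⟩ := hpath.exists_split hE _ _ (hc k r hkpos) rfl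
  obtain ⟨k', hk', h₂⟩ := h₂.exists_pump_syllableWord hE (fun i => hM ▸ (hkM i).le) r
  have hy := hbound _ ((hL _).2 ⟨i, hi, f, hf, h₁.trans h₂⟩)
  have hne' : ∀ i, ∀ j < r, k' j ≠ k i := fun i j hj h => by
    obtain ⟨h₁, h₂⟩ := hk' j hj
    rw [h, ← hM] at h₂
    rw [h] at h₁
    have h₃ : j + 1 < i + 1 := Nat.lt_of_mul_lt_mul_right h₁
    have h₄ : (j + 2) * (M + 1) ≤ (i + 1) * (M + 1) := Nat.mul_le_mul_right _ (by omega)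
    have h₅ : (j + 2) * (M + 1) = (j + 1) * (M + 1) + (M + 1) := by ring
    simp only [k] at h₂
    omega
  have hr := le_card_support_sum_signedSingle hn hkinj hkpos hne'
  rw [hU] at hy
  set W := FreeGroup.mk (syllableWord k r) with hW
  set W' := FreeGroup.mk (syllableWord k' r) with hW'
  have hWs : syllableCount n W = ∑ i ∈ Finset.range r, signedSingle n (k i) := by
    rw [hW, syllableCount_mk (isReduced_syllableWord k r),
      syllableSum_syllableWord (δ := signedSingle n) (signedSingle_zero n)]
  have hWs' : syllableCount n W' = ∑ i ∈ Finset.range r, signedSingle n (k' i) := by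
    rw [hW', syllableCount_mk (isReduced_syllableWord k' r),
      syllableSum_syllableWord (δ := signedSingle n) (signedSingle_zero n)]
  have d₁ := card_support_syllableCount_mul_le (n := n) (W⁻¹ * z) W'
  have d₂ := card_support_syllableCount_mul_le (n := n) W⁻¹ z
  rw [← hWs, ← hWs'] at hr
  have key : syllableCount n W' - syllableCount n W =
      syllableCount n (W⁻¹ * z * W') - syllableCount n z -
      (syllableCount n (W⁻¹ * z * W') - syllableCount n (W⁻¹ * z) - syllableCount n W') -
      (syllableCount n (W⁻¹ * z) - syllableCount n W⁻¹ - syllableCount n z) := by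
    rw [syllableCount_inv]; abel
  rw [key] at hr
  have e₁ := card_support_sub_le (syllableCount n (W⁻¹ * z * W') - syllableCount n z -
      (syllableCount n (W⁻¹ * z * W') - syllableCount n (W⁻¹ * z) - syllableCount n W'))
      (syllableCount n (W⁻¹ * z) - syllableCount n W⁻¹ - syllableCount n z)
  have e₂ := card_support_sub_le (syllableCount n (W⁻¹ * z * W') - syllableCount n z)
      (syllableCount n (W⁻¹ * z * W') - syllableCount n (W⁻¹ * z) - syllableCount n W')
  have e₃ := card_support_sub_le (syllableCount n (W⁻¹ * z * W')) (syllableCount n z)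
  omega

/-! ### Groups with a free non-abelian quotient -/

theorem exists_surjective_freeGroup_bool {F : Type v} [Group F] [IsFreeGroup F]
    (hF : ∃ a b : F, a * b ≠ b * a) :
    ∃ ψ : F →* FreeGroup Bool, Function.Surjective ψ := by
  classical
  -- If any two free generators were equal, the group would be cyclic.
  obtain ⟨x, y, hxy⟩ : ∃ x y : IsFreeGroup.Generators F, x ≠ y := by
    by_contra! hall
    obtain ⟨a, b, hab⟩ := hF
    refine hab ((IsFreeGroup.toFreeGroup F).injective ?_)
    rw [map_mul, map_mul]
    generalize IsFreeGroup.toFreeGroup F a = a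
    generalize IsFreeGroup.toFreeGroup F b = b
    have hof : ∀ z (b : FreeGroup (IsFreeGroup.Generators F)),
        Commute (FreeGroup.of z) b := fun z b => by
      induction b using FreeGroup.induction_on with
      | C1 => exact Commute.one_right _
      | of t => rw [hall z t]
      | inv_of t h => exact h.inv_right
      | mul _ _ h₁ h₂ => exact h₁.mul_right h₂
    change Commute a b
    induction a using FreeGroup.induction_on with
    | C1 => exact Commute.one_left _
    | of t => exact hof t b
    | inv_of t h => exact h.inv_left
    | mul _ _ h₁ h₂ => exact h₁.mul_left h₂
  have hsurj : Function.Surjective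
      (FreeGroup.map fun z : IsFreeGroup.Generators F => decide (z = x)) := fun g => by
    refine ⟨FreeGroup.map (fun β => if β then x else y) g, ?_⟩
    rw [FreeGroup.map.comp]
    have hid : ((fun z => decide (z = x)) ∘ fun β : Bool => if β then x else y) = id := by
      funext β
      cases β
      · simpa using hxy.symm
      · simp
    rw [hid, FreeGroup.map.id]
  exact ⟨(FreeGroup.map fun z => decide (z = x)).comp (IsFreeGroup.toFreeGroup F).toMonoidHom,
    hsurj.comp (IsFreeGroup.toFreeGroup F).surjective⟩

theorem corollary5p11 :
    -- homomorphic images of rational sets are rational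
    (∀ (M : Type u) (N : Type v) [Monoid M] [Monoid N] (φ : M →* N) (L : Set M),
      IsRationalSubset L → IsRationalSubset (φ '' L)) ∧
    -- `w[G] = φ(w[H])` for a surjective homomorphism `φ : H → G`
    (∀ (H : Type u) (G : Type v) [Group H] [Group G] (φ : H →* G), Function.Surjective φ →
      ∀ w : GroupWord, verbalSet w G = φ '' verbalSet w H) ∧
    -- non-rationality of all proper verbal sets lifts from quotients
    (∀ (H : Type u) (G : Type v) [Group H] [Group G] (φ : H →* G), Function.Surjective φ →
      (∀ w : GroupWord, IsProperWord.{p} w → ¬ IsRationalSubset (verbalSet w G)) →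
      ∀ w : GroupWord, IsProperWord.{p} w → ¬ IsRationalSubset (verbalSet w H)) ∧
    -- groups with a free non-abelian quotient
    (∀ (H : Type u) (F : Type v) [Group H] [Group F] [IsFreeGroup F],
      (∃ a b : F, a * b ≠ b * a) →
      ∀ φ : H →* F, Function.Surjective φ →
      ∀ w : GroupWord, IsProperWord.{p} w → ¬ IsRationalSubset (verbalSet w H)) := by
  refine ⟨fun _ _ _ _ φ _ hL => hL.image φ, fun _ _ _ _ _ hφ w => verbalSet_eq_image hφ w,
    fun _ _ _ _ _ hφ h w hw => not_isRationalSubset_verbalSet_of_surjective hφ (h w hw),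
    fun H F _ _ _ hF φ hφ w hw => ?_⟩
  obtain ⟨ψ, hψ⟩ := exists_surjective_freeGroup_bool hF
  exact not_isRationalSubset_verbalSet_of_surjective (φ := ψ.comp φ) (hψ.comp hφ)
    (not_isRationalSubset_verbalSet_freeGroup_bool hw)
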